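/- Let $(\mathscr{A},E)$ be a tracial $W^*$-probability space, i.e. $\mathscr{A}$ is a von Neumann algebra of operators and $E$ is a unital, weakly continuous, positive, faithful, tracial linear functional on $\mathscr{A}$. The law of a self-adjoint $w\in\mathscr{A}$ is the unique Borel probability measure $\mu_w$ on $\mathbb{R}$ with $E(w^m)=\int_{\mathbb{R}} t^m\,d\mu_w(t)$ for all integers $m\ge 0$. Let $x,y\in\mathscr{A}$ be freely independent self-adjoint elements, each having as its law the centered semicircular distribution of variance one, with density $\frac{1}{2\pi}\sqrt{4-u^2}\,\mathbf{1}_{(-2,2)}(u)$. The law $\mathscr{T}$ of $\frac{1}{\sqrt2}(xy+yx)$ is called the tetilla law. All its moments $m_k(\mathscr{T})=\int_{\mathbb{R}}t^k\,d\mathscr{T}(t)$ are finite, all its odd moments vanish, that is, $m_{2n+1}(\mathscr{T})=0$ for every integer $n\ge 0$, and for every integer $n\ge 1$, $$m_{2n}(\mathscr{T})=\frac{1}{2^n\,n}\sum_{k=1}^{n}2^k\binom{2n}{k-1}\binom{n}{k}.$$ -/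

import Mathlib

universe u

noncomputable section

/-! ### Tracial W*-probability spaces -/

/-- `(M, E)` is a tracial `W*`-probability space: `M` is a von Neumann algebra of operators on the
Hilbert space `H`, and `E` is a unital linear functional on `M` which is weakly continuous,
positive, faithful and tracial. Weak continuity is continuity for the ultraweak topology
(normality): `E` is a sum of vector functionals `a ↦ ⟪ξ k, a (η k)⟫` with square-summable families
`ξ` and `η`. (Functionals that are continuous for the weak operator topology are finite sums of
this kind.) -/
structure IsTracialWStarState {H : Type*} [NormedAddCommGroup H] [InnerProductSpace ℂ H]
    [CompleteSpace H] (M : VonNeumannAlgebra H) (E : M.toStarSubalgebra →ₗ[ℂ] ℂ) : Prop where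
  map_one : E 1 = 1
  weaklyContinuous : ∃ ξ η : ℕ → H, Summable (fun k => ‖ξ k‖ ^ 2) ∧ Summable (fun k => ‖η k‖ ^ 2) ∧
    ∀ a : M.toStarSubalgebra, HasSum (fun k => inner ℂ (ξ k) ((a : H →L[ℂ] H) (η k))) (E a)
  nonneg : ∀ a : M.toStarSubalgebra, 0 ≤ (E (a * star a)).re ∧ (E (a * star a)).im = 0
  faithful : ∀ a : M.toStarSubalgebra, E (a * star a) = 0 → a = 0
  tracial : ∀ a b : M.toStarSubalgebra, E (a * b) = E (b * a)

/-! ### Laws of random variables -/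

/-- `μ` is a Borel probability measure on `ℝ` such that `E (x ^ m) = ∫ t ^ m dμ(t)` for every
`m ≥ 0`, the integrals being absolutely convergent. -/
structure IsLaw {A : Type*} [Ring A] [Algebra ℂ A] (E : A →ₗ[ℂ] ℂ) (x : A)
    (μ : MeasureTheory.Measure ℝ) : Prop where
  isProbabilityMeasure : MeasureTheory.IsProbabilityMeasure μ
  integrable : ∀ m : ℕ, MeasureTheory.Integrable (fun t : ℝ => t ^ m) μ
  moment : ∀ m : ℕ, E (x ^ m) = ((∫ t : ℝ, t ^ m ∂μ : ℝ) : ℂ)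

open Classical in
/-- The law of `x`: the unique Borel probability measure on `ℝ` with the same moments as `x`.
For a self-adjoint element of a tracial `W*`-probability space it exists and is unique, see
`IsTracialWStarState.existsUnique_isLaw` below; where there is no such unique measure, the value is
the zero measure, which is not a probability measure. -/
def law {A : Type*} [Ring A] [Algebra ℂ A] (E : A →ₗ[ℂ] ℂ) (x : A) : MeasureTheory.Measure ℝ :=
  if h : ∃! μ, IsLaw E x μ then h.choose else 0

section Existence

open MeasureTheory

/-- A measure with the moments of a compactly supported probability measure lives on the same
interval. -/
theorem ae_mem_Icc_of_moments {μ ν : Measure ℝ} [IsProbabilityMeasure μ] {R : ℝ} (hR : 0 ≤ R)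
    (hμ : ∀ᵐ t ∂μ, t ∈ Set.Icc (-R) R)
    (hν : ∀ m : ℕ, Integrable (fun t : ℝ => t ^ m) ν)
    (h : ∀ m : ℕ, ∫ t : ℝ, t ^ m ∂ν = ∫ t : ℝ, t ^ m ∂μ) :
    ∀ᵐ t ∂ν, t ∈ Set.Icc (-R) R := by
  have hμm (m : ℕ) : ∫ t : ℝ, t ^ (2 * m) ∂μ ≤ R ^ (2 * m) := by
    have h1 : ∫ t : ℝ, t ^ (2 * m) ∂μ ≤ ∫ _ : ℝ, R ^ (2 * m) ∂μ := by
      refine integral_mono_of_nonneg (Filter.Eventually.of_forall fun t => ?_)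
        (integrable_const _) ?_
      · exact (even_two_mul m).pow_nonneg t
      · filter_upwards [hμ] with t ht
        rw [pow_mul, pow_mul]
        exact pow_le_pow_left₀ (sq_nonneg _) (sq_le_sq' ht.1 ht.2) _
    simpa using h1
  have key (R' : ℝ) (hR' : R < R') : ν {t | R' ≤ |t|} = 0 := by
    have hpos : 0 < R' := hR.trans_lt hR'
    have h0 : ν.real {t | R' ≤ |t|} ≤ 0 := by
      have hlim : Filter.Tendsto (fun m : ℕ => ((R / R') ^ 2) ^ m) Filter.atTop (nhds 0) := by
        refine tendsto_pow_atTop_nhds_zero_of_lt_one (sq_nonneg _) ?_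
        have : R / R' < 1 := (div_lt_one hpos).2 hR'
        have h0 : 0 ≤ R / R' := by positivity
        nlinarith
      refine ge_of_tendsto' hlim fun m => ?_
      have hmk := mul_meas_ge_le_integral_of_nonneg (μ := ν) (f := fun t : ℝ => t ^ (2 * m))
        (Filter.Eventually.of_forall fun t => (even_two_mul m).pow_nonneg t) (hν _) (R' ^ (2 * m))
      have hset : {t : ℝ | R' ≤ |t|} ⊆ {t : ℝ | R' ^ (2 * m) ≤ t ^ (2 * m)} := by
        intro t ht
        simp only [Set.mem_ofPred_eq] at ht ⊢
        calc R' ^ (2 * m) ≤ |t| ^ (2 * m) := pow_le_pow_left₀ hpos.le ht _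
          _ = t ^ (2 * m) := (even_two_mul m).pow_abs t
      have hfin : ν Set.univ ≠ ⊤ := by
        have := (hν 0)
        simp only [pow_zero] at this
        rw [integrable_const_iff] at this
        rcases this with h | h
        · exact absurd h one_ne_zero
        · exact h.measure_univ_lt_top.ne
      have : IsFiniteMeasure ν := ⟨hfin.lt_top⟩
      have h3 := measureReal_mono (μ := ν) hset
      rw [h (2 * m)] at hmk
      rw [div_pow, div_pow, ← pow_mul, ← pow_mul, le_div_iff₀ (by positivity), mul_comm]
      exact (mul_le_mul_of_nonneg_left h3 (by positivity)).trans (hmk.trans (hμm m))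
    have hfin : ν Set.univ ≠ ⊤ := by
      have := (hν 0)
      simp only [pow_zero] at this
      rw [integrable_const_iff] at this
      rcases this with h | h
      · exact absurd h one_ne_zero
      · exact h.measure_univ_lt_top.ne
    have : IsFiniteMeasure ν := ⟨hfin.lt_top⟩
    exact (measureReal_eq_zero_iff).1 (le_antisymm h0 measureReal_nonneg)
  have hU : ν (⋃ k : ℕ, {t : ℝ | R + 1 / ((k : ℝ) + 1) ≤ |t|}) = 0 :=
    measure_iUnion_null fun k => key _ (by
      have : (0 : ℝ) < 1 / ((k : ℝ) + 1) := by positivity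
      linarith)
  rw [ae_iff]
  refine measure_mono_null (fun t ht => ?_) hU
  simp only [Set.mem_ofPred_eq, Set.mem_Icc, ← abs_le, not_le] at ht
  obtain ⟨k, hk⟩ := exists_nat_one_div_lt (sub_pos.2 ht)
  exact Set.mem_iUnion.2 ⟨k, by simp only [Set.mem_ofPred_eq]; linarith⟩

theorem eq_of_moments {μ ν : Measure ℝ} [IsProbabilityMeasure μ] [IsProbabilityMeasure ν] {R : ℝ}
    (hμ : ∀ᵐ t ∂μ, t ∈ Set.Icc (-R) R) (hν : ∀ᵐ t ∂ν, t ∈ Set.Icc (-R) R)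
    (hμi : ∀ m : ℕ, Integrable (fun t : ℝ => t ^ m) μ)
    (hνi : ∀ m : ℕ, Integrable (fun t : ℝ => t ^ m) ν)
    (h : ∀ m : ℕ, ∫ t : ℝ, t ^ m ∂ν = ∫ t : ℝ, t ^ m ∂μ) : μ = ν := by
  have hpi (κ : Measure ℝ) (hκ : ∀ m : ℕ, Integrable (fun t : ℝ => t ^ m) κ)
      (p : Polynomial ℝ) : Integrable (fun t => p.eval t) κ := by
    simp only [Polynomial.eval_eq_sum_range]
    exact integrable_finsetSum _ fun i _ => (hκ i).const_mul _
  have hp (p : Polynomial ℝ) : ∫ t, p.eval t ∂μ = ∫ t, p.eval t ∂ν := by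
    simp only [Polynomial.eval_eq_sum_range]
    rw [integral_finsetSum _ fun i _ => (hμi i).const_mul _,
      integral_finsetSum _ fun i _ => (hνi i).const_mul _]
    simp only [integral_const_mul, h]
  refine ext_of_forall_integral_eq_of_IsFiniteMeasure fun f => ?_
  have hclose (ε : ℝ) (hε : 0 < ε) : |∫ t, f t ∂μ - ∫ t, f t ∂ν| ≤ ε + ε := by
    obtain ⟨p, hpε⟩ := exists_polynomial_near_of_continuousOn (-R) R f f.continuous.continuousOn ε hε
    have step (κ : Measure ℝ) [IsProbabilityMeasure κ] (hκ : ∀ᵐ t ∂κ, t ∈ Set.Icc (-R) R)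
        (hκi : ∀ m : ℕ, Integrable (fun t : ℝ => t ^ m) κ) :
        |∫ t, p.eval t ∂κ - ∫ t, f t ∂κ| ≤ ε := by
      rw [← integral_sub (hpi κ hκi p) (f.integrable κ)]
      have := norm_integral_le_of_norm_le_const (μ := κ) (f := fun t => p.eval t - f t) (C := ε)
        (by filter_upwards [hκ] with t ht using (hpε t ht).le)
      simpa using this
    have h1 := abs_le.1 (step μ hμ hμi)
    have h2 := abs_le.1 (step ν hν hνi)
    rw [hp] at h1
    exact abs_le.2 ⟨by linarith, by linarith⟩
  refine sub_eq_zero.1 (abs_nonpos_iff.1 (le_of_forall_pos_le_add fun ε hε => ?_))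
  have := hclose (ε / 2) (by positivity)
  linarith

variable {H : Type*} [NormedAddCommGroup H] [InnerProductSpace ℂ H] [CompleteSpace H]
  {M : VonNeumannAlgebra H} {E : M.toStarSubalgebra →ₗ[ℂ] ℂ}

theorem IsTracialWStarState.im_eq_zero (hE : IsTracialWStarState M E) {x : M.toStarSubalgebra}
    (hx : IsSelfAdjoint x) : (E x).im = 0 := by
  have h1 := (hE.nonneg (1 + x)).2
  have h2 := (hE.nonneg x).2
  rw [star_add, star_one, hx.star_eq, add_mul, one_mul, mul_add, mul_one] at h1
  rw [hx.star_eq] at h2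
  simp only [map_add, Complex.add_im, hE.map_one, Complex.one_im, h2] at h1
  linarith

/-- Every random variable has a compactly supported law. -/
theorem IsTracialWStarState.exists_isLaw (hE : IsTracialWStarState M E) {x : M.toStarSubalgebra}
    (hx : IsSelfAdjoint x) :
    ∃ μ : Measure ℝ, IsLaw E x μ ∧ ∃ R : ℝ, 0 ≤ R ∧ ∀ᵐ t ∂μ, t ∈ Set.Icc (-R) R := by
  have hx' : IsSelfAdjoint (x : H →L[ℂ] H) := congrArg Subtype.val hx
  let S := spectrum ℝ (x : H →L[ℂ] H)
  have hS : IsCompact S := spectrum.isCompact (𝕜 := ℝ) (x : H →L[ℂ] H)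
  have : CompactSpace S := isCompact_iff_compactSpace.1 hS
  let φ : C(S, ℝ) →⋆ₐ[ℝ] (H →L[ℂ] H) := cfcHom hx'
  have hmem (f : C(S, ℝ)) : φ f ∈ M.toStarSubalgebra := by
    have : φ f ∈ M.commutant.commutant := by
      rw [VonNeumannAlgebra.mem_commutant_iff]
      intro g hg
      have hc : Commute (x : H →L[ℂ] H) g := VonNeumannAlgebra.mem_commutant_iff.1 hg _ x.2
      exact (IsSelfAdjoint.commute_cfcHom hx' hx' hc f).symm
    rw [VonNeumannAlgebra.commutant_commutant] at this
    exact this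
  let φM : C(S, ℝ) → M.toStarSubalgebra := fun f => ⟨φ f, hmem f⟩
  let Λ : CompactlySupportedContinuousMap S ℝ →ₚ[ℝ] ℝ := PositiveLinearMap.mk₀
    { toFun := fun f => (E (φM (f : C(S, ℝ)))).re
      map_add' := fun f g => by
        have : φM ((f + g : CompactlySupportedContinuousMap S ℝ) : C(S, ℝ)) =
            φM (f : C(S, ℝ)) + φM (g : C(S, ℝ)) := by
          apply Subtype.ext
          exact map_add φ (f : C(S, ℝ)) (g : C(S, ℝ))
        rw [this, map_add, Complex.add_re]
      map_smul' := fun c f => by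
        have : φM ((c • f : CompactlySupportedContinuousMap S ℝ) : C(S, ℝ)) =
            (c : ℂ) • φM (f : C(S, ℝ)) := by
          apply Subtype.ext
          exact (map_smul φ c (f : C(S, ℝ))).trans (Complex.coe_smul c _).symm
        rw [this, map_smul]
        simp }
    (by
      intro f hf
      let g : C(S, ℝ) := ⟨fun s => Real.sqrt (f s), by fun_prop⟩
      have hg : (f : C(S, ℝ)) = g * star g := by
        ext s
        exact (Real.mul_self_sqrt (hf s)).symm
      have : φM (f : C(S, ℝ)) = φM g * star (φM g) := by
        apply Subtype.ext
        change φ (f : C(S, ℝ)) = φ g * star (φ g)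
        rw [hg, map_mul, map_star]
      change 0 ≤ (E (φM (f : C(S, ℝ)))).re
      rw [this]
      exact (hE.nonneg _).1)
  let ρ : Measure S := RealRMK.rieszMeasure Λ
  have hint (m : ℕ) : ∫ s : S, (s : ℝ) ^ m ∂ρ = (E (x ^ m)).re := by
    let f : C(S, ℝ) := (ContinuousMap.restrict S (.id ℝ)) ^ m
    have := RealRMK.integral_rieszMeasure Λ (CompactlySupportedContinuousMap.continuousMapEquiv f)
    refine (Eq.trans ?_ this).trans ?_
    · rfl
    · change (E (φM f)).re = _
      have : φM f = x ^ m := by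
        apply Subtype.ext
        change φ f = (x : H →L[ℂ] H) ^ m
        rw [map_pow]
        congr 1
        exact cfcHom_id hx'
      rw [this]
  have hρ : IsProbabilityMeasure ρ := by
    have h := hint 0
    simp only [pow_zero, hE.map_one, Complex.one_re, integral_const, smul_eq_mul, mul_one] at h
    refine ⟨?_⟩
    rw [Measure.real, ENNReal.toReal_eq_one_iff] at h
    exact h
  have hmeas : AEMeasurable (Subtype.val : S → ℝ) ρ := measurable_subtype_coe.aemeasurable
  refine ⟨ρ.map Subtype.val, ⟨Measure.isProbabilityMeasure_map hmeas, fun m => ?_, fun m => ?_⟩, ?_⟩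
  · rw [integrable_map_measure (by fun_prop) hmeas]
    exact (CompactlySupportedContinuousMap.continuousMapEquiv
      ((ContinuousMap.restrict S (.id ℝ)) ^ m)).integrable
  · rw [integral_map hmeas (by fun_prop), hint]
    apply Complex.ext
    · simp
    · simpa using hE.im_eq_zero (hx.pow m)
  · obtain ⟨R, hR⟩ := hS.isBounded.subset_closedBall (0 : ℝ)
    refine ⟨max R 0, le_max_right _ _, ?_⟩
    refine (ae_map_iff (p := fun t => t ∈ Set.Icc (-max R 0) (max R 0)) hmeas
      measurableSet_Icc).2 (Filter.Eventually.of_forall fun s => ?_)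
    have := hR s.2
    rw [mem_closedBall_zero_iff, Real.norm_eq_abs] at this
    exact abs_le.1 (this.trans (le_max_left _ _))

/-- Every random variable has a unique law. -/
theorem IsTracialWStarState.existsUnique_isLaw (hE : IsTracialWStarState M E)
    {x : M.toStarSubalgebra} (hx : IsSelfAdjoint x) : ∃! μ : Measure ℝ, IsLaw E x μ := by
  obtain ⟨μ, hμ, R, hR, hsupp⟩ := hE.exists_isLaw hx
  refine ⟨μ, hμ, fun ν hν => ?_⟩
  have := hμ.isProbabilityMeasure
  have := hν.isProbabilityMeasure
  have hm (m : ℕ) : ∫ t : ℝ, t ^ m ∂ν = ∫ t : ℝ, t ^ m ∂μ :=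
    Complex.ofReal_injective ((hν.moment m).symm.trans (hμ.moment m))
  exact (eq_of_moments hsupp (ae_mem_Icc_of_moments hR hsupp hν.integrable hm)
    hμ.integrable hν.integrable hm).symm

theorem IsTracialWStarState.isLaw_law (hE : IsTracialWStarState M E) {x : M.toStarSubalgebra}
    (hx : IsSelfAdjoint x) : IsLaw E x (law E x) := by
  have h := hE.existsUnique_isLaw hx
  rw [law, dif_pos h]
  exact h.choose_spec.1

end Existence

/-! ### Free independence -/

/-- Unital subalgebras `B i` are freely independent: `E (a₁ ⋯ aₘ) = 0` whenever `m ≥ 1`, every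
`aⱼ` is a centered element of some `B (i j)`, and consecutive indices `i j` are distinct. -/
def FreelyIndependent {A ι : Type*} [Ring A] [Algebra ℂ A] (E : A →ₗ[ℂ] ℂ)
    (B : ι → Subalgebra ℂ A) : Prop :=
  ∀ (m : ℕ) (i : Fin (m + 1) → ι) (a : Fin (m + 1) → A),
    (∀ j, a j ∈ B (i j)) → (∀ j, E (a j) = 0) → (∀ j : Fin m, i j.castSucc ≠ i j.succ) →
      E (List.ofFn a).prod = 0

/-- Random variables are freely independent if the unital subalgebras they generate are. -/
def FreeVariables {A ι : Type*} [Ring A] [Algebra ℂ A] (E : A →ₗ[ℂ] ℂ) (x : ι → A) : Prop :=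
  FreelyIndependent E fun i => Algebra.adjoin ℂ {x i}

/-! ### The semicircular law -/

/-- The centered semicircular distribution `S(0, t)` of variance `t > 0`, with density
`(2 π t)⁻¹ √(4 t - u²)` on the interval `(-2 √t, 2 √t)`. -/
def semicircularLaw (t : ℝ) : MeasureTheory.Measure ℝ :=
  MeasureTheory.volume.withDensity fun u => ENNReal.ofReal
    ((Set.Ioo (-(2 * Real.sqrt t)) (2 * Real.sqrt t)).indicator
      (fun u => 1 / (2 * Real.pi * t) * Real.sqrt (4 * t - u ^ 2)) u)

/-! ### The tetilla law -/

/-- `μ` is the tetilla law: the law of `(x y + y x) / √2`, where `x` and `y` are two freely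
independent random variables (self-adjoint elements of a tracial `W*`-probability space) with the
centered semicircular distribution of variance one. -/
def IsTetillaLaw (μ : MeasureTheory.Measure ℝ) : Prop :=
  ∃ (H : Type u) (_ : NormedAddCommGroup H) (_ : InnerProductSpace ℂ H) (_ : CompleteSpace H)
    (M : VonNeumannAlgebra H) (E : M.toStarSubalgebra →ₗ[ℂ] ℂ) (x y : M.toStarSubalgebra),
    IsTracialWStarState M E ∧ IsSelfAdjoint x ∧ IsSelfAdjoint y ∧
      law E x = semicircularLaw 1 ∧ law E y = semicircularLaw 1 ∧ FreeVariables E ![x, y] ∧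
      μ = law E (((1 / Real.sqrt 2 : ℝ) : ℂ) • (x * y + y * x))

end

/-! Let `a i` be the field operators on the algebraic Fock space of words, `Ω` the vacuum, `T = a i
* a j + a j * a i`. Freeness enters once: sending a word to its Wick product carries `a i` to left
multiplication by `x i`, and a nonempty word goes to an alternating product of Chebyshev
polynomials, each centered for the semicircular law, so `E` kills it. Hence `E ((x i * x j + x j * x
i) ^ n)` is the vacuum coefficient of `T ^ n Ω` (`map_anticommutator_pow`).

Right annihilation commutes with field operators up to a rank-one vacuum term
(`rightAnnihilation_fieldOp`). Pushing it through `T ^ n` gives Schwinger–Dyson recursions. They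
close because `T` is even and each `a k` is odd, so mixed terms have no vacuum part. With `M` the
generating function of the vacuum moments and `G = X * M`, eliminating the auxiliary series gives
`(1 - G²) M = 1 + G²` (`anticommMoments_equation`).

Thus `G = X φ(G)` with `φ(z) = (1 + z²) / (1 - z²)`. Lagrange inversion
(`PowerSeries.lagrange_inversion`) reads off the coefficients: `φ` is even, so odd moments vanish,
and expanding `1 + 2z² / (1 - z²)` gives the binomial sum. The factor `1/√2` supplies `2⁻ⁿ`. -/

open Polynomial

noncomputable section

/-! ### The free Fock space -/

section Fock

variable {ι : Type*}

/-- The vacuum vector. -/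
def vacuum (ι : Type*) : List ι →₀ ℂ := Finsupp.single [] 1

/-- The coefficient of the vacuum vector. -/
def vacuumCoeff (ι : Type*) : (List ι →₀ ℂ) →ₗ[ℂ] ℂ := Finsupp.lapply []

/-- The sign of the length of words. -/
def parityOp (ι : Type*) : Module.End ℂ (List ι →₀ ℂ) :=
  Finsupp.linearCombination ℂ fun w => Finsupp.single w ((-1) ^ w.length)

theorem vacuumCoeff_single (w : List ι) (c : ℂ) :
    vacuumCoeff ι (Finsupp.single w c) = if w = [] then c else 0 := by
  simp [vacuumCoeff, Finsupp.single_apply]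

theorem vacuumCoeff_vacuum : vacuumCoeff ι (vacuum ι) = 1 := by
  simp [vacuum, vacuumCoeff]

theorem parityOp_vacuum : parityOp ι (vacuum ι) = vacuum ι := by
  simp [parityOp, vacuum]

theorem vacuumCoeff_parityOp (v : List ι →₀ ℂ) :
    vacuumCoeff ι (parityOp ι v) = vacuumCoeff ι v := by
  have h : vacuumCoeff ι ∘ₗ parityOp ι = vacuumCoeff ι := by
    refine Finsupp.lhom_ext' fun w => LinearMap.ext_ring ?_
    rcases w with _ | ⟨k, w⟩ <;> simp [parityOp, vacuumCoeff_single]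
  exact congrArg (fun f => f v) h

variable [DecidableEq ι]

/-- Left annihilation of a letter, on words. -/
def annihilateWord (i : ι) : List ι → (List ι →₀ ℂ)
  | [] => 0
  | j :: w => if j = i then Finsupp.single w 1 else 0

/-- The field operator `l i + (l i)⋆` on the algebraic free Fock space with basis the words. -/
def fieldOp (i : ι) : Module.End ℂ (List ι →₀ ℂ) :=
  Finsupp.linearCombination ℂ fun w => Finsupp.single (i :: w) 1 + annihilateWord i w

/-- Right annihilation of a letter. -/
def rightAnnihilation (i : ι) : Module.End ℂ (List ι →₀ ℂ) :=
  Finsupp.linearCombination ℂ fun w =>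
    if w.getLast? = some i then Finsupp.single w.dropLast 1 else 0

theorem fieldOp_single (i : ι) (w : List ι) :
    fieldOp i (Finsupp.single w 1) = Finsupp.single (i :: w) 1 + annihilateWord i w := by
  simp [fieldOp]

theorem rightAnnihilation_single (i : ι) (w : List ι) :
    rightAnnihilation i (Finsupp.single w 1) =
      if w.getLast? = some i then Finsupp.single w.dropLast 1 else 0 := by
  simp [rightAnnihilation]

theorem rightAnnihilation_vacuum (i : ι) : rightAnnihilation i (vacuum ι) = 0 := by
  simp [vacuum, rightAnnihilation_single]

/-- The commutator of a right annihilation and a field operator has rank at most one. -/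
theorem rightAnnihilation_fieldOp (i j : ι) (v : List ι →₀ ℂ) :
    rightAnnihilation i (fieldOp j v) = fieldOp j (rightAnnihilation i v) +
      if i = j then vacuumCoeff ι v • vacuum ι else 0 := by
  have h : rightAnnihilation i ∘ₗ fieldOp j = fieldOp j ∘ₗ rightAnnihilation i +
      if i = j then (vacuumCoeff ι).smulRight (vacuum ι) else 0 := by
    refine Finsupp.lhom_ext' fun w => LinearMap.ext_ring ?_
    -- On nonempty words the operators act at opposite ends and commute; the defect comes from the
    -- empty word, where the created letter is both first and last.
    rcases w with _ | ⟨k, _ | ⟨l, w⟩⟩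
    · by_cases hij : i = j
      · simp [fieldOp_single, rightAnnihilation_single, annihilateWord, vacuumCoeff_single, hij,
          vacuum]
      · simp [fieldOp_single, rightAnnihilation_single, annihilateWord, hij, Ne.symm hij]
    · by_cases hij : i = j <;> by_cases hk : k = j <;> by_cases hk' : k = i <;>
        simp_all [fieldOp_single, rightAnnihilation_single, annihilateWord, vacuumCoeff_single]
    · by_cases hij : i = j <;> by_cases hk : k = j <;>
        by_cases hl : (l :: w).getLast? = some i <;>
        simp_all [fieldOp_single, rightAnnihilation_single, annihilateWord, vacuumCoeff_single]
  have := congrArg (fun f => f v) h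
  split_ifs at this ⊢ <;> simpa using this

/-- Only the word `[i]` contributes to either side, and on a one-letter word left and right
annihilation agree. This lets a leftmost field operator be traded for an operator that passes
through the others. -/
theorem vacuumCoeff_fieldOp (i : ι) (v : List ι →₀ ℂ) :
    vacuumCoeff ι (fieldOp i v) = vacuumCoeff ι (rightAnnihilation i v) := by
  have h : vacuumCoeff ι ∘ₗ fieldOp i = vacuumCoeff ι ∘ₗ rightAnnihilation i := by
    refine Finsupp.lhom_ext' fun w => LinearMap.ext_ring ?_
    rcases w with _ | ⟨k, _ | ⟨l, w⟩⟩
    · simp [fieldOp_single, rightAnnihilation_single, annihilateWord, vacuumCoeff_single]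
    · by_cases hk : k = i <;>
        simp [fieldOp_single, rightAnnihilation_single, annihilateWord, vacuumCoeff_single, hk]
    · by_cases hk : k = i <;> by_cases hl : (l :: w).getLast? = some i <;>
        simp_all [fieldOp_single, rightAnnihilation_single, annihilateWord, vacuumCoeff_single]
  exact congrArg (fun f => f v) h

theorem parityOp_fieldOp (i : ι) (v : List ι →₀ ℂ) :
    parityOp ι (fieldOp i v) = -fieldOp i (parityOp ι v) := by
  have h : parityOp ι ∘ₗ fieldOp i = -(fieldOp i ∘ₗ parityOp ι) := by
    refine Finsupp.lhom_ext' fun w => LinearMap.ext_ring ?_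
    have hs (w : List ι) : parityOp ι (Finsupp.single w 1) =
        (-1 : ℂ) ^ w.length • Finsupp.single w 1 := by
      simp [parityOp]
    simp only [LinearMap.comp_apply, Finsupp.lsingle_apply, LinearMap.neg_apply, hs, map_smul,
      fieldOp_single, map_add, List.length_cons, smul_add]
    rcases w with _ | ⟨k, w⟩
    · simp [annihilateWord]
    · by_cases hk : k = i
      · simp [annihilateWord, hk, hs, pow_succ, -Finsupp.smul_single]
        abel
      · simp [annihilateWord, hk, pow_succ, -Finsupp.smul_single]
  exact congrArg (fun f => f v) h

/-! ### The anticommutator of two field operators -/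

/-- The anticommutator of two field operators. -/
def anticomm (i j : ι) : Module.End ℂ (List ι →₀ ℂ) :=
  fieldOp i * fieldOp j + fieldOp j * fieldOp i

theorem anticomm_comm (i j : ι) : anticomm i j = anticomm j i := add_comm _ _

theorem parityOp_anticomm_pow (i j : ι) (n : ℕ) (v : List ι →₀ ℂ) :
    parityOp ι ((anticomm i j ^ n) v) = (anticomm i j ^ n) (parityOp ι v) := by
  induction n with
  | zero => rfl
  | succ n ih =>
    rw [pow_succ', Module.End.mul_apply, Module.End.mul_apply, ← ih]
    simp only [anticomm, LinearMap.add_apply, Module.End.mul_apply, map_add, parityOp_fieldOp,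
      map_neg, neg_neg]

/-- An odd number of field operators acts on the vacuum, so by parity the number equals its own
negative. -/
theorem vacuumCoeff_fieldOp_anticomm_pow (i j k : ι) (n : ℕ) :
    vacuumCoeff ι (fieldOp k ((anticomm i j ^ n) (vacuum ι))) = 0 := by
  refine self_eq_neg.1 ?_
  conv_lhs => rw [← vacuumCoeff_parityOp, parityOp_fieldOp, parityOp_anticomm_pow,
    parityOp_vacuum, map_neg]

theorem vacuumCoeff_anticomm_pow_fieldOp (i j k : ι) (n : ℕ) :
    vacuumCoeff ι ((anticomm i j ^ n) (fieldOp k (vacuum ι))) = 0 := by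
  refine self_eq_neg.1 ?_
  conv_lhs => rw [← vacuumCoeff_parityOp, parityOp_anticomm_pow, parityOp_fieldOp,
    parityOp_vacuum, map_neg, map_neg]

theorem rightAnnihilation_anticomm {i j : ι} (hij : i ≠ j) (v : List ι →₀ ℂ) :
    rightAnnihilation i (anticomm i j v) = anticomm i j (rightAnnihilation i v) +
      (vacuumCoeff ι (fieldOp j v) • vacuum ι + vacuumCoeff ι v • fieldOp j (vacuum ι)) := by
  simp only [anticomm, LinearMap.add_apply, Module.End.mul_apply, map_add,
    rightAnnihilation_fieldOp, if_true, if_neg hij, add_zero, map_smul]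
  abel

/-- A Leibniz rule: the sum runs over the factor at which the commutator defect occurs, with `p.1`
factors to its left and `p.2` to its right. The resulting convolutions become products of generating
functions. -/
theorem rightAnnihilation_anticomm_pow {i j : ι} (hij : i ≠ j) (n : ℕ) (v : List ι →₀ ℂ) :
    rightAnnihilation i ((anticomm i j ^ (n + 1)) v) =
      (anticomm i j ^ (n + 1)) (rightAnnihilation i v) +
      ∑ p ∈ Finset.HasAntidiagonal.antidiagonal n,
        (vacuumCoeff ι (fieldOp j ((anticomm i j ^ p.2) v)) • (anticomm i j ^ p.1) (vacuum ι) +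
          vacuumCoeff ι ((anticomm i j ^ p.2) v) •
            (anticomm i j ^ p.1) (fieldOp j (vacuum ι))) := by
  induction n with
  | zero => simp [rightAnnihilation_anticomm hij]
  | succ n ih =>
    rw [pow_succ', Module.End.mul_apply, rightAnnihilation_anticomm hij, ih, map_add,
      ← Module.End.mul_apply, ← pow_succ', map_sum, Finset.Nat.antidiagonal_succ]
    simp only [map_add, map_smul, Finset.sum_cons, Finset.sum_map, Function.Embedding.coeFn_mk,
      Function.Embedding.prodMap, Prod.map, Function.Embedding.refl_apply, pow_zero,
      Module.End.one_apply, ← Module.End.mul_apply, ← pow_succ']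
    simp only [Nat.succ_eq_add_one, pow_succ', Module.End.mul_apply]
    abel

/-! ### Schwinger–Dyson equations for the vacuum moments. -/

/-- The generating function of the vacuum moments of the anticommutator. -/
def anticommMoments (i j : ι) : PowerSeries ℂ :=
  PowerSeries.mk fun n => vacuumCoeff ι ((anticomm i j ^ n) (vacuum ι))

/-- The generating function of the vacuum expectations of `aₖ (aᵢ aⱼ + aⱼ aᵢ)ⁿ aₗ`. -/
def dressedMoments (i j k l : ι) : PowerSeries ℂ :=
  PowerSeries.mk fun n => vacuumCoeff ι (fieldOp k ((anticomm i j ^ n) (fieldOp l (vacuum ι))))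

theorem dressedMoments_mixed {i j : ι} (hij : i ≠ j) :
    dressedMoments i j i j = PowerSeries.X * (anticommMoments i j * dressedMoments i j j j) := by
  ext n
  rcases n with _ | n
  · simp [dressedMoments, vacuumCoeff_fieldOp, rightAnnihilation_fieldOp, hij,
      rightAnnihilation_vacuum]
  · rw [PowerSeries.coeff_succ_X_mul, PowerSeries.coeff_mul]
    simp only [dressedMoments, anticommMoments, PowerSeries.coeff_mk]
    rw [vacuumCoeff_fieldOp, rightAnnihilation_anticomm_pow hij]
    simp only [rightAnnihilation_fieldOp, if_neg hij, rightAnnihilation_vacuum, map_zero, add_zero,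
      zero_add, map_sum, map_add, map_smul, vacuumCoeff_anticomm_pow_fieldOp, mul_zero,
      smul_eq_mul]
    exact Finset.sum_congr rfl fun p _ => mul_comm _ _

/-- Unlike in the mixed case, the right annihilation now also removes the innermost letter; this is
the term `anticommMoments i j`. -/
theorem dressedMoments_diag {i j : ι} (hij : i ≠ j) :
    dressedMoments i j j j = anticommMoments i j +
      PowerSeries.X * (anticommMoments i j * dressedMoments i j i j) := by
  ext n
  rcases n with _ | n
  · simp [dressedMoments, anticommMoments, vacuumCoeff_fieldOp, rightAnnihilation_fieldOp,
      rightAnnihilation_vacuum, vacuumCoeff_vacuum]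
  · rw [map_add, PowerSeries.coeff_succ_X_mul, PowerSeries.coeff_mul]
    simp only [dressedMoments, anticommMoments, PowerSeries.coeff_mk]
    rw [vacuumCoeff_fieldOp, anticomm_comm, rightAnnihilation_anticomm_pow hij.symm]
    simp only [rightAnnihilation_fieldOp, if_true, rightAnnihilation_vacuum, map_zero,
      zero_add, map_sum, map_add, map_smul, vacuumCoeff_anticomm_pow_fieldOp, mul_zero,
      smul_eq_mul, add_zero, vacuumCoeff_vacuum, one_smul]
    exact congrArg _ (Finset.sum_congr rfl fun p _ => mul_comm _ _)

theorem mk_fieldOp_fieldOp_anticomm_pow {i j : ι} (hij : i ≠ j) :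
    (PowerSeries.mk fun n =>
        vacuumCoeff ι (fieldOp i (fieldOp j ((anticomm i j ^ n) (vacuum ι))))) =
      PowerSeries.X * (dressedMoments i j j j * anticommMoments i j) := by
  ext n
  rcases n with _ | n
  · simp [vacuumCoeff_fieldOp, rightAnnihilation_fieldOp, hij, rightAnnihilation_vacuum]
  · rw [PowerSeries.coeff_succ_X_mul, PowerSeries.coeff_mul]
    simp only [dressedMoments, anticommMoments, PowerSeries.coeff_mk]
    rw [vacuumCoeff_fieldOp, rightAnnihilation_fieldOp, if_neg hij, add_zero,
      rightAnnihilation_anticomm_pow hij]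
    simp only [rightAnnihilation_vacuum, map_zero, zero_add, map_sum, map_add, map_smul,
      vacuumCoeff_fieldOp_anticomm_pow, smul_eq_mul, zero_mul]
    exact Finset.sum_congr rfl fun p _ => mul_comm _ _

/-- The functional equation of the moment generating function of the anticommutator. -/
theorem anticommMoments_equation {i j : ι} (hij : i ≠ j) :
    (1 - (PowerSeries.X * anticommMoments i j) ^ 2) * anticommMoments i j =
      1 + (PowerSeries.X * anticommMoments i j) ^ 2 := by
  -- Peel one factor `T` off `T ^ (n + 1)` and treat its two products separately.
  have h0 : anticommMoments i j = 1 + PowerSeries.X *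
      (PowerSeries.X * (dressedMoments i j j j * anticommMoments i j) +
        PowerSeries.X * (dressedMoments i j i i * anticommMoments i j)) := by
    have h (k l : ι) : dressedMoments k l = dressedMoments l k := by
      ext; simp [dressedMoments, anticomm_comm k l]
    have h' : anticommMoments i j = anticommMoments j i := by
      simp [anticommMoments, anticomm_comm i j]
    conv_rhs => rw [← mk_fieldOp_fieldOp_anticomm_pow hij, h i j, h',
      ← mk_fieldOp_fieldOp_anticomm_pow hij.symm]
    ext n
    rcases n with _ | n
    · simp [anticommMoments, vacuumCoeff_vacuum]
    · rw [map_add, PowerSeries.coeff_succ_X_mul, map_add, PowerSeries.coeff_one,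
        if_neg n.succ_ne_zero]
      simp only [anticommMoments, PowerSeries.coeff_mk, anticomm_comm j i, pow_succ',
        Module.End.mul_apply, zero_add]
      rw [← map_add]
      rfl
  -- The mixed and diagonal equations form a linear system; eliminating the mixed series leaves this
  -- one.
  have h (i j : ι) (hij : i ≠ j) : (1 - (PowerSeries.X * anticommMoments i j) ^ 2) *
      dressedMoments i j j j = anticommMoments i j := by
    have h1 := dressedMoments_diag hij
    rw [dressedMoments_mixed hij] at h1
    linear_combination h1
  have h1 := h i j hij
  have h2 := h j i hij.symm
  have e1 : dressedMoments j i = dressedMoments i j := by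
    ext; simp [dressedMoments, anticomm_comm i j]
  have e2 : anticommMoments j i = anticommMoments i j := by
    simp [anticommMoments, anticomm_comm i j]
  rw [e1, e2] at h2
  linear_combination (1 - (PowerSeries.X * anticommMoments i j) ^ 2) * h0 +
    PowerSeries.X ^ 2 * anticommMoments i j * (h1 + h2)

end Fock

/-! ### Wick products of free variables -/

section Wick

variable {ι : Type*} {A : Type*} [Ring A] [Algebra ℂ A]

theorem FreelyIndependent.map_prod_eq_zero {E : A →ₗ[ℂ] ℂ} {B : ι → Subalgebra ℂ A}
    (h : FreelyIndependent E B) {l : List (ι × A)} (hl : l ≠ []) (hB : ∀ p ∈ l, p.2 ∈ B p.1)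
    (hE : ∀ p ∈ l, E p.2 = 0) (hc : l.IsChain fun p q => p.1 ≠ q.1) :
    E (l.map Prod.snd).prod = 0 := by
  obtain ⟨m, hm⟩ : ∃ m, l.length = m + 1 :=
    Nat.exists_eq_succ_of_ne_zero (List.length_pos_iff.2 hl).ne'
  have key := h m (fun k => (l.get (k.cast hm.symm)).1) (fun k => (l.get (k.cast hm.symm)).2)
    (fun k => hB _ (List.get_mem _ _)) (fun k => hE _ (List.get_mem _ _))
    (fun k => List.isChain_iff_getElem.1 hc k.1 (by have := k.2; omega))
  convert! key using 2
  congr 1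
  apply List.ext_getElem
  · simp [hm]
  · intro n h1 h2
    simp only [List.getElem_map, List.getElem_ofFn, List.get_eq_getElem, Fin.val_cast]

variable [DecidableEq ι]

/-- The Wick product of a word in the variables `x`. -/
def wick (x : ι → A) : List ι → A
  | [] => 1
  | [i] => x i
  | i :: j :: w => x i * wick x (j :: w) - if j = i then wick x w else 0

/-- The recursion defining `wick`, solved for `x i * wick x (j :: w)`, is creation plus
annihilation. -/
theorem linearCombination_wick_fieldOp (x : ι → A) (i : ι) (v : List ι →₀ ℂ) :
    Finsupp.linearCombination ℂ (wick x) (fieldOp i v) =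
      x i * Finsupp.linearCombination ℂ (wick x) v := by
  have h : Finsupp.linearCombination ℂ (wick x) ∘ₗ fieldOp i =
      LinearMap.mulLeft ℂ (x i) ∘ₗ Finsupp.linearCombination ℂ (wick x) := by
    refine Finsupp.lhom_ext' fun w => LinearMap.ext_ring ?_
    rcases w with _ | ⟨k, w⟩
    · simp [fieldOp_single, annihilateWord, wick]
    · by_cases hk : k = i <;> simp [fieldOp_single, annihilateWord, wick, hk]
  exact congrArg (fun f => f v) h

/-- Wick products are alternating products of Chebyshev polynomials in the variables. -/
theorem exists_wick_eq_prod (x : ι → A) (i : ι) (w : List ι) :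
    ∃ (n : ℕ) (l : List (ι × ℕ)),
      wick x (i :: w) = aeval (x i) (Chebyshev.S ℂ (n + 1)) *
        (l.map fun p => aeval (x p.1) (Chebyshev.S ℂ (p.2 + 1))).prod ∧
      wick x w = aeval (x i) (Chebyshev.S ℂ n) *
        (l.map fun p => aeval (x p.1) (Chebyshev.S ℂ (p.2 + 1))).prod ∧
      ((i, n) :: l).IsChain fun p q => p.1 ≠ q.1 := by
  -- Each pair in `(i, n) :: l` is a maximal run of equal letters, stored as letter and length minus
  -- one. The product for the tail `w` is carried along because lengthening a run uses the
  -- three-term Chebyshev recursion.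
  induction w generalizing i with
  | nil => exact ⟨0, [], by simp [wick], by simp [wick], by simp⟩
  | cons j w ih =>
    obtain ⟨n, l, h1, h2, h3⟩ := ih j
    by_cases hij : j = i
    · subst hij
      refine ⟨n + 1, l, ?_, by simpa using h1, ?_⟩
      · rw [wick, if_pos rfl, h1, h2, Nat.cast_add, Nat.cast_one, add_assoc, one_add_one_eq_two,
          Chebyshev.S_add_two, map_sub, map_mul, aeval_X, sub_mul, mul_assoc]
      · rw [List.isChain_cons] at h3 ⊢
        exact h3
    · refine ⟨0, (j, n) :: l, ?_, ?_, ?_⟩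
      · rw [wick, if_neg hij, h1]
        simp
      · simp [h1]
      · rw [List.isChain_cons]
        refine ⟨?_, h3⟩
        simp [Ne.symm hij]

theorem map_wick_eq_zero {E : A →ₗ[ℂ] ℂ} {x : ι → A} (hx : FreeVariables E x)
    (hS : ∀ i (n : ℕ), E (aeval (x i) (Chebyshev.S ℂ (n + 1))) = 0) {w : List ι} (hw : w ≠ []) :
    E (wick x w) = 0 := by
  rcases w with _ | ⟨i, w⟩
  · exact absurd rfl hw
  obtain ⟨n, l, h1, -, h3⟩ := exists_wick_eq_prod x i w
  have := FreelyIndependent.map_prod_eq_zero (E := E) hx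
    (l := ((i, n) :: l).map fun p => (p.1, aeval (x p.1) (Chebyshev.S ℂ (p.2 + 1)))) (by simp)
    (by
      intro p hp
      obtain ⟨q, -, rfl⟩ := List.mem_map.1 hp
      exact aeval_mem_adjoin_singleton _ _)
    (by
      intro p hp
      obtain ⟨q, -, rfl⟩ := List.mem_map.1 hp
      exact hS _ _)
    (by rw [List.isChain_map]; exact h3)
  rw [h1]
  simpa [Function.comp_def] using this

theorem map_linearCombination_wick {E : A →ₗ[ℂ] ℂ} {x : ι → A} (hE : E 1 = 1)
    (hx : FreeVariables E x)
    (hS : ∀ i (n : ℕ), E (aeval (x i) (Chebyshev.S ℂ (n + 1))) = 0) (v : List ι →₀ ℂ) :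
    E (Finsupp.linearCombination ℂ (wick x) v) = vacuumCoeff ι v := by
  have h : E ∘ₗ Finsupp.linearCombination ℂ (wick x) = vacuumCoeff ι := by
    refine Finsupp.lhom_ext' fun w => LinearMap.ext_ring ?_
    rcases w with _ | ⟨k, w⟩
    · simp [wick, hE, vacuumCoeff_single]
    · simp [map_wick_eq_zero hx hS, vacuumCoeff_single]
  exact congrArg (fun f => f v) h

/-- The moments of the anticommutator of free semicircular variables are vacuum moments. -/
theorem map_anticommutator_pow {E : A →ₗ[ℂ] ℂ} {x : ι → A} (hE : E 1 = 1)
    (hx : FreeVariables E x)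
    (hS : ∀ i (n : ℕ), E (aeval (x i) (Chebyshev.S ℂ (n + 1))) = 0) (i j : ι) (n : ℕ) :
    E ((x i * x j + x j * x i) ^ n) = PowerSeries.coeff n (anticommMoments i j) := by
  have h : Finsupp.linearCombination ℂ (wick x) ((anticomm i j ^ n) (vacuum ι)) =
      (x i * x j + x j * x i) ^ n := by
    induction n with
    | zero => simp [vacuum, wick]
    | succ n ih =>
      rw [pow_succ', Module.End.mul_apply, pow_succ', ← ih]
      simp only [anticomm, LinearMap.add_apply, Module.End.mul_apply, map_add,
        linearCombination_wick_fieldOp]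
      rw [add_mul, mul_assoc, mul_assoc]
  rw [← h, map_linearCombination_wick hE hx hS, anticommMoments, PowerSeries.coeff_mk]

end Wick

/-! ### Lagrange inversion -/

namespace PowerSeries

variable {K : Type*} [Field K] [CharZero K]

/-- The residue of `G' / G ^ (m + 1)`, where `G = X * M`. -/
theorem coeff_derivative_X_mul_mul_inv_pow {M : K⟦X⟧} (hM : constantCoeff M ≠ 0) (m : ℕ) :
    coeff m (derivative K (X * M) * M⁻¹ ^ (m + 1)) = if m = 0 then 1 else 0 := by
  have hinv : M * M⁻¹ = 1 := PowerSeries.mul_inv_cancel M hM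
  have hG : derivative K (X * M) = M + X * derivative K M := by
    rw [Derivation.leibniz, derivative_X, smul_eq_mul, smul_eq_mul]
    ring
  rcases m with _ | m
  · rw [hG, coeff_zero_eq_constantCoeff_apply]
    simp [hM]
  -- This says, without negative powers of `X`, that `G' / G ^ (m + 2)` is a multiple of the
  -- derivative of `G⁻¹ ^ (m + 1)` and so has no residue: on the right the two coefficients of `X ^
  -- (m + 1)` cancel.
  · have h : ((m + 1 : ℕ) : K⟦X⟧) * (derivative K (X * M) * M⁻¹ ^ (m + 1 + 1)) =
        ((m + 1 : ℕ) : K⟦X⟧) * M⁻¹ ^ (m + 1) - X * derivative K (M⁻¹ ^ (m + 1)) := by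
      rw [hG, derivative_pow, derivative_inv', Nat.add_sub_cancel]
      linear_combination ((m + 1 : ℕ) : K⟦X⟧) * M⁻¹ ^ (m + 1) * hinv
    have h1 := congrArg (coeff (m + 1)) h
    rw [map_sub, coeff_succ_X_mul, coeff_derivative, ← nsmul_eq_mul, ← nsmul_eq_mul, map_nsmul,
      map_nsmul, nsmul_eq_mul, nsmul_eq_mul] at h1
    have h2 : ((m + 1 : ℕ) : K) ≠ 0 := Nat.cast_ne_zero.2 m.succ_ne_zero
    rw [if_neg m.succ_ne_zero]
    refine (mul_eq_zero.1 (h1.trans ?_)).resolve_left h2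
    push_cast
    ring

/-- Lagrange inversion: the solution `G = X * M` of `G = X * φ(G)`. -/
theorem lagrange_inversion {M φ : K⟦X⟧} (hφ : constantCoeff φ ≠ 0)
    (h : M = φ.subst (X * M)) (n : ℕ) :
    (n + 1) * coeff n M = coeff n (φ ^ (n + 1)) := by
  have hG : HasSubst (X * M) := HasSubst.of_constantCoeff_zero' (by simp)
  have hM : constantCoeff M ≠ 0 := by
    -- Since `X * M` has no constant term, `M` inherits the constant term of `φ`.
    have h1 := congrArg (subst (X * M)) (eq_X_pow_mul_shift_add_trunc 1 φ)
    rw [← h, subst_add hG, subst_mul hG, pow_one, subst_X hG] at h1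
    have h2 := congrArg constantCoeff h1
    simp at h2
    rwa [h2]
  have hinv : M * M⁻¹ = 1 := PowerSeries.mul_inv_cancel M hM
  -- Cutting at degree `n` keeps the substituted sum finite; the remainder is divisible by `X ^ (n +
  -- 1)` and does not reach the coefficient of `X ^ n`.
  obtain ⟨ψ, hψ⟩ : ∃ ψ, φ ^ (n + 1) = X ^ (n + 1) * ψ + (trunc (n + 1) (φ ^ (n + 1)) : K⟦X⟧) :=
    ⟨_, eq_X_pow_mul_shift_add_trunc _ _⟩
  have h1 := congrArg (subst (X * M)) hψ
  rw [subst_pow hG, ← h, subst_add hG, subst_mul hG, subst_pow hG, subst_X hG, subst_coe hG,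
    aeval_eq_sum_range' (natDegree_trunc_lt _ _)] at h1
  -- The expansion of `M ^ (n + 1)` is multiplied by `G' / M ^ (n + 1)`. In the coefficient of `X ^
  -- n` the residue lemma then keeps only `k = n`.
  have h2 : derivative K (X * M) = X ^ (n + 1) * (derivative K (X * M) * subst (X * M) ψ) +
      ∑ k ∈ Finset.range (n + 1), (trunc (n + 1) (φ ^ (n + 1))).coeff k •
        (X ^ k * (derivative K (X * M) * M⁻¹ ^ (n - k + 1))) := by
    have e1 : derivative K (X * M) = derivative K (X * M) * M⁻¹ ^ (n + 1) * M ^ (n + 1) := by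
      rw [mul_assoc, ← mul_pow, mul_comm M⁻¹, hinv, one_pow, mul_one]
    have e2 (k : ℕ) : M⁻¹ ^ k * M ^ k = 1 := by rw [← mul_pow, mul_comm M⁻¹, hinv, one_pow]
    conv_lhs => rw [e1, h1, mul_add, Finset.mul_sum]
    congr 1
    · linear_combination X ^ (n + 1) * derivative K (X * M) * subst (X * M) ψ * e2 (n + 1)
    · refine Finset.sum_congr rfl fun k hk => ?_
      have hk' : n + 1 = n - k + 1 + k := by
        have := Finset.mem_range.1 hk
        omega
      rw [mul_smul_comm]
      congr 1
      nth_rw 1 [hk']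
      linear_combination X ^ k * derivative K (X * M) * M⁻¹ ^ (n - k + 1) * e2 k
  have h3 := congrArg (coeff n) h2
  rw [coeff_derivative, coeff_succ_X_mul, map_add, coeff_X_pow_mul', if_neg (by omega), zero_add,
    map_sum, Finset.sum_range_succ, Finset.sum_eq_zero] at h3
  · simp only [map_smul, smul_eq_mul, coeff_X_pow_mul', le_refl, if_true, Nat.sub_self,
      coeff_derivative_X_mul_mul_inv_pow hM, zero_add, mul_one, coeff_trunc] at h3
    rw [if_pos n.lt_succ_self] at h3
    rw [mul_comm, h3]
  · intro k hk
    have := Finset.mem_range.1 hk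
    rw [map_smul, coeff_X_pow_mul', if_pos this.le, coeff_derivative_X_mul_mul_inv_pow hM,
      if_neg (by omega), smul_zero]

/-- The coefficients of the powers of `(1 + X) / (1 - X)`. -/
theorem coeff_one_add_two_mul_X_mul_pow (N n : ℕ) :
    coeff (n + 1) ((1 + 2 * X * mk 1 : K⟦X⟧) ^ N) =
      ∑ k ∈ Finset.Icc 1 (n + 1), 2 ^ k * (N.choose k : K) * (n.choose (k - 1) : K) := by
  have hc (k : ℕ) : coeff (n + 1) ((2 * X * mk 1 : K⟦X⟧) ^ k) =
      if k ∈ Finset.Icc 1 (n + 1) then 2 ^ k * (n.choose (k - 1) : K) else 0 := by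
    rcases k with _ | k
    · simp [coeff_one]
    · rw [mul_pow, mul_pow, mk_one_pow_eq_mk_choose_add, mul_assoc,
        show (2 : K⟦X⟧) ^ (k + 1) = C (2 ^ (k + 1)) by rw [map_pow, map_ofNat], coeff_C_mul, coeff_X_pow_mul']
      by_cases hk : k + 1 ≤ n + 1
      · have : k + (n - k) = n := by omega
        simp [hk, coeff_mk, this]
      · simp [hk]
  rw [add_comm (1 : K⟦X⟧), add_pow, map_sum]
  have hterm (k : ℕ) : coeff (n + 1) ((2 * X * mk 1 : K⟦X⟧) ^ k * 1 ^ (N - k) * (N.choose k : K⟦X⟧))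
      = if k ∈ Finset.Icc 1 (n + 1) then
        2 ^ k * (N.choose k : K) * (n.choose (k - 1) : K) else 0 := by
    rw [one_pow, mul_one, mul_comm, ← nsmul_eq_mul, map_nsmul, hc, nsmul_eq_mul]
    split_ifs
    · ring
    · simp
  simp only [hterm]
  rw [← Finset.sum_filter]
  refine Finset.sum_subset_zero_on_sdiff (fun k hk => (Finset.mem_filter.1 hk).2) (fun k hk => ?_)
    fun _ _ => rfl
  -- The binomial sum stops at `N`, the stated one at `n + 1`; surplus indices carry a zero binomial
  -- coefficient.
  have : N < k := by
    by_contra hN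
    simp only [Finset.mem_sdiff, Finset.mem_filter, Finset.mem_range] at hk
    exact hk.2 ⟨by omega, hk.1⟩
  simp [Nat.choose_eq_zero_of_lt this]

/-- The coefficients of the solution of `(1 - (X M)²) M = 1 + (X M)²`. -/
theorem lagrange_coeff {M : K⟦X⟧} (h : (1 - (X * M) ^ 2) * M = 1 + (X * M) ^ 2) (n : ℕ) :
    (n + 1) * coeff n M =
      coeff n (expand 2 two_ne_zero ((1 + 2 * X * mk 1 : K⟦X⟧) ^ (n + 1))) := by
  have hG : HasSubst (X * M) := HasSubst.of_constantCoeff_zero' (by simp)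
  -- Here `mk 1` is the geometric series, so the second factor is `(1 + X) / (1 - X)`; `expand 2`
  -- turns it into `φ`.
  have hθ : (1 - X) * (1 + 2 * X * mk 1 : K⟦X⟧) = 1 + X := by
    linear_combination 2 * X * mk_one_mul_one_sub_eq_one K
  have hφ : (1 - X ^ 2) * expand 2 two_ne_zero (1 + 2 * X * mk 1 : K⟦X⟧) = 1 + X ^ 2 := by
    have := congrArg (expand 2 two_ne_zero) hθ
    simpa only [map_mul, map_sub, map_add, map_one, expand_X] using this
  have hsub := congrArg (substAlgHom (R := K) hG) hφ
  simp only [map_mul, map_sub, map_add, map_one, map_pow, substAlgHom_X] at hsub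
  rw [map_pow]
  refine lagrange_inversion (by simp [map_add, constantCoeff_expand]) ?_ n
  have h0 : (1 - (X * M) ^ 2 : K⟦X⟧) ≠ 0 := fun h => by
    have := congrArg constantCoeff h
    simp at this
  refine mul_left_cancel₀ h0 (h.trans ?_)
  rw [← coe_substAlgHom hG, ← hsub]
  simp

theorem coeff_odd_eq_zero {M : K⟦X⟧} (h : (1 - (X * M) ^ 2) * M = 1 + (X * M) ^ 2) (n : ℕ) :
    coeff (2 * n + 1) M = 0 := by
  have h1 := lagrange_coeff h (2 * n + 1)
  rw [coeff_expand_of_not_dvd _ _ _ (by omega)] at h1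
  exact (mul_eq_zero.1 h1).resolve_left (by exact_mod_cast (2 * n + 1).succ_ne_zero)

theorem coeff_even {M : K⟦X⟧} (h : (1 - (X * M) ^ 2) * M = 1 + (X * M) ^ 2) {n : ℕ} (hn : 1 ≤ n) :
    coeff (2 * n) M = 1 / n *
      ∑ k ∈ Finset.Icc 1 n, 2 ^ k * ((2 * n).choose (k - 1) : K) * (n.choose k : K) := by
  obtain ⟨n, rfl⟩ := Nat.exists_eq_add_of_le' hn
  have h1 := lagrange_coeff h (2 * (n + 1))
  rw [coeff_expand_mul, coeff_one_add_two_mul_X_mul_pow] at h1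
  have h0 : (((2 * (n + 1) : ℕ) : K) + 1) ≠ 0 := by exact_mod_cast (2 * (n + 1)).succ_ne_zero
  refine mul_left_cancel₀ h0 (h1.trans ?_)
  rw [Finset.mul_sum, Finset.mul_sum]
  refine Finset.sum_congr rfl fun k hk => ?_
  obtain ⟨k, rfl⟩ := Nat.exists_eq_add_of_le' (Finset.mem_Icc.1 hk).1
  -- Absorption in both binomials moves the factors `2n + 1` and `1/n` (for the original `n`)
  -- across, term by term.
  have e1 := congrArg (Nat.cast (R := K)) (Nat.add_one_mul_choose_eq (2 * (n + 1)) k)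
  have e2 := congrArg (Nat.cast (R := K)) (Nat.add_one_mul_choose_eq n k)
  have hn : (((n + 1 : ℕ)) : K) ≠ 0 := Nat.cast_ne_zero.2 n.succ_ne_zero
  have hk : (((k + 1 : ℕ)) : K) ≠ 0 := Nat.cast_ne_zero.2 k.succ_ne_zero
  rw [Nat.cast_mul, Nat.cast_mul] at e1 e2
  rw [Nat.add_sub_cancel]
  refine mul_right_cancel₀ hk (mul_left_cancel₀ hn ?_)
  have e3 : ((n + 1 : ℕ) : K) * (1 / ((n + 1 : ℕ) : K)) = 1 := mul_one_div_cancel hn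
  push_cast at e1 e2 e3 ⊢
  linear_combination (-2 ^ (k + 1) * ((n : K) + 1) * (n.choose k : K)) * e1 +
    2 ^ (k + 1) * (2 * ((n : K) + 1) + 1) * ((2 * (n + 1)).choose k : K) * e2 -
    2 ^ (k + 1) * (2 * ((n : K) + 1) + 1) * ((2 * (n + 1)).choose k : K) *
      ((n + 1).choose (k + 1) : K) * ((k : K) + 1) * e3

end PowerSeries

/-! ### Orthogonality for the semicircular law -/

open MeasureTheory in
-- The substitution `u = 2 cos θ`, obtained by rescaling to `[-1, 1]` and passing through the
-- Chebyshev measure of the first kind.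
theorem integral_semicircularLaw_one (f : ℝ → ℝ) :
    ∫ u, f u ∂semicircularLaw 1 =
      ∫ θ in 0..Real.pi, 2 / Real.pi * (f (2 * Real.cos θ) * Real.sin θ ^ 2) := by
  have h1 : ∫ u, f u ∂semicircularLaw 1 =
      ∫ u in (-2)..2, 1 / (2 * Real.pi) * Real.sqrt (4 - u ^ 2) * f u := by
    rw [semicircularLaw, integral_withDensity_eq_integral_toReal_smul]
    · rw [intervalIntegral.integral_of_le (by norm_num), integral_Ioc_eq_integral_Ioo,
        ← integral_indicator measurableSet_Ioo]
      refine integral_congr_ae (Filter.Eventually.of_forall fun u => ?_)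
      by_cases hu : u ∈ Set.Ioo (-2 : ℝ) 2
      · have : 0 ≤ Real.pi⁻¹ * 2⁻¹ * Real.sqrt (4 - u ^ 2) := by positivity
        simp [Set.indicator_of_mem hu, this]
      · simp [Set.indicator_of_notMem hu]
    · exact (Measurable.indicator (by fun_prop) measurableSet_Ioo).ennreal_ofReal
    · exact Filter.Eventually.of_forall fun _ => ENNReal.ofReal_lt_top
  have h2 := intervalIntegral.integral_comp_mul_left (a := -1) (b := 1)
    (fun u => 1 / (2 * Real.pi) * Real.sqrt (4 - u ^ 2) * f u) (two_ne_zero (α := ℝ))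
  have h3 := Chebyshev.integral_measureT (fun v => 2 / Real.pi * (f (2 * v) * (1 - v ^ 2)))
  rw [Chebyshev.integral_measureT_eq_integral_cos] at h3
  simp only [Real.sin_sq]
  rw [h1, h3]
  have h4 : ∫ u in (-2)..2, 1 / (2 * Real.pi) * Real.sqrt (4 - u ^ 2) * f u =
      2 * ∫ v in (-1)..1, 1 / (2 * Real.pi) * Real.sqrt (4 - (2 * v) ^ 2) * f (2 * v) := by
    rw [h2, smul_eq_mul, mul_inv_cancel_left₀ two_ne_zero, mul_neg_one, mul_one]
  rw [h4, ← intervalIntegral.integral_const_mul]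
  refine intervalIntegral.integral_congr fun v _ => ?_
  have e1 : Real.sqrt (4 - (2 * v) ^ 2) = 2 * Real.sqrt (1 - v ^ 2) := by
    rw [show 4 - (2 * v) ^ 2 = 2 ^ 2 * (1 - v ^ 2) by ring, Real.sqrt_mul (by norm_num),
      Real.sqrt_sq (by norm_num)]
  have e2 : (1 - v ^ 2) * Real.sqrt (1 - v ^ 2)⁻¹ = Real.sqrt (1 - v ^ 2) := by
    rw [Real.sqrt_inv, ← div_eq_mul_inv, Real.div_sqrt]
  rw [e1, ← e2]
  field_simp

/-- Since `S (n + 1)` at `2 cos θ` times `sin θ` is `sin ((n + 2) θ)`, the integrand is a difference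
of cosines of the nonzero frequencies `n + 1` and `n + 3`, each with zero integral over `[0, π]`. -/
theorem integral_chebyshevS_semicircularLaw (n : ℕ) :
    ∫ u, (Chebyshev.S ℝ (n + 1)).eval u ∂semicircularLaw 1 = 0 := by
  rw [integral_semicircularLaw_one, intervalIntegral.integral_const_mul]
  have hcos (m : ℕ) : ∫ θ in 0..Real.pi, Real.cos (((m + 1 : ℕ) : ℝ) * θ) = 0 := by
    rw [intervalIntegral.integral_comp_mul_left _ (Nat.cast_ne_zero.2 m.succ_ne_zero), integral_cos,
      Real.sin_nat_mul_pi]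
    simp
  have h : ∫ θ in 0..Real.pi, (Chebyshev.S ℝ (n + 1)).eval (2 * Real.cos θ) * Real.sin θ ^ 2 =
      ∫ θ in 0..Real.pi, 1 / 2 * (Real.cos (((n + 1 : ℕ) : ℝ) * θ) -
        Real.cos (((n + 2 + 1 : ℕ) : ℝ) * θ)) := by
    refine intervalIntegral.integral_congr fun θ _ => ?_
    have h1 := Chebyshev.S_two_mul_real_cos θ (n + 1)
    have h2 := Real.cos_sub_cos (((n + 1 : ℕ) : ℝ) * θ) (((n + 2 + 1 : ℕ) : ℝ) * θ)
    have e1 : (((n + 1 : ℕ) : ℝ) * θ + ((n + 2 + 1 : ℕ) : ℝ) * θ) / 2 =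
        (((n + 1 : ℤ) : ℝ) + 1) * θ := by push_cast; ring
    have e2 : (((n + 1 : ℕ) : ℝ) * θ - ((n + 2 + 1 : ℕ) : ℝ) * θ) / 2 = -θ := by push_cast; ring
    rw [e1, e2, Real.sin_neg] at h2
    rw [h2, ← h1]
    ring
  rw [h, intervalIntegral.integral_const_mul, intervalIntegral.integral_sub, hcos, hcos]
  · simp
  all_goals exact Continuous.intervalIntegrable (by fun_prop) _ _

/-! ### From laws to expectations, and the moments of the tetilla law. -/

theorem IsLaw.map_aeval {A : Type*} [Ring A] [Algebra ℂ A] {E : A →ₗ[ℂ] ℂ} {x : A}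
    {μ : MeasureTheory.Measure ℝ} (h : IsLaw E x μ) (p : ℝ[X]) :
    E (aeval x (p.map (algebraMap ℝ ℂ))) = ((∫ t, p.eval t ∂μ : ℝ) : ℂ) := by
  rw [aeval_eq_sum_range, natDegree_map, map_sum]
  simp only [eval_eq_sum_range]
  rw [MeasureTheory.integral_finsetSum _ fun i _ => (h.integrable i).const_mul _]
  simp [MeasureTheory.integral_const_mul, h.moment]

theorem IsTracialWStarState.map_chebyshevS {H : Type*} [NormedAddCommGroup H]
    [InnerProductSpace ℂ H] [CompleteSpace H] {M : VonNeumannAlgebra H}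
    {E : M.toStarSubalgebra →ₗ[ℂ] ℂ} (hE : IsTracialWStarState M E) {x : M.toStarSubalgebra}
    (hx : IsSelfAdjoint x) (hlaw : law E x = semicircularLaw 1) (n : ℕ) :
    E (aeval x (Chebyshev.S ℂ (n + 1))) = 0 := by
  have h := (hE.isLaw_law hx).map_aeval (Chebyshev.S ℝ (n + 1))
  rw [hlaw, integral_chebyshevS_semicircularLaw, Chebyshev.map_S] at h
  simpa using h

end

theorem mainTheorem4 (μ : MeasureTheory.Measure ℝ) (hμ : IsTetillaLaw.{u} μ) :
    (∀ n : ℕ, MeasureTheory.Integrable (fun t : ℝ => t ^ n) μ) ∧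
      (∀ n : ℕ, ∫ t : ℝ, t ^ (2 * n + 1) ∂μ = 0) ∧
      ∀ n : ℕ, 1 ≤ n →
        ∫ t : ℝ, t ^ (2 * n) ∂μ =
          1 / (2 ^ n * (n : ℝ)) *
            ∑ k ∈ Finset.Icc 1 n, 2 ^ k * ((2 * n).choose (k - 1) : ℝ) * (n.choose k : ℝ) := by
  obtain ⟨H, _, _, _, M, E, x, y, hE, hx, hy, hlx, hly, hfree, rfl⟩ := hμ
  have hsa : IsSelfAdjoint (((1 / Real.sqrt 2 : ℝ) : ℂ) • (x * y + y * x)) := by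
    refine IsSelfAdjoint.smul (Complex.conj_ofReal _) ?_
    rw [IsSelfAdjoint, star_add, star_mul, star_mul, hx.star_eq, hy.star_eq, add_comm]
  have hlaw := hE.isLaw_law hsa
  have hS (i : Fin 2) (n : ℕ) : E (aeval (![x, y] i) (Chebyshev.S ℂ (n + 1))) = 0 := by
    fin_cases i
    · exact hE.map_chebyshevS hx hlx n
    · exact hE.map_chebyshevS hy hly n
  -- All analysis ends here: what remains concerns the coefficients of one power series.
  have hmom (n : ℕ) : ((∫ t, t ^ n ∂law E (((1 / Real.sqrt 2 : ℝ) : ℂ) • (x * y + y * x)) : ℝ) : ℂ) =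
      ((1 / Real.sqrt 2 : ℝ) : ℂ) ^ n * PowerSeries.coeff n (anticommMoments (0 : Fin 2) 1) := by
    rw [← hlaw.moment, _root_.smul_pow, map_smul, smul_eq_mul,
      ← map_anticommutator_pow hE.map_one hfree hS 0 1]
    rfl
  have heq := anticommMoments_equation (zero_ne_one (α := Fin 2))
  refine ⟨hlaw.integrable, fun n => ?_, fun n hn => ?_⟩
  · refine Complex.ofReal_injective ((hmom (2 * n + 1)).trans ?_)
    rw [PowerSeries.coeff_odd_eq_zero heq, mul_zero, Complex.ofReal_zero]
  · refine Complex.ofReal_injective ((hmom (2 * n)).trans ?_)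
    have h2 : (1 / Real.sqrt 2) ^ (2 * n) = 1 / 2 ^ n := by
      rw [pow_mul, div_pow, one_pow, Real.sq_sqrt (by norm_num), div_pow, one_pow]
    rw [PowerSeries.coeff_even heq hn, ← Complex.ofReal_pow, h2]
    push_cast
    rw [← mul_assoc, ← one_div_mul_one_div]
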